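/- Let $\mathbb S^3=\{(z_1,z_2)\in\mathbb C^2: |z_1|^2+|z_2|^2=1\}$ with its round metric, volume measure $\mathrm{dVol}$ and one-dimensional Hausdorff measure $\mathscr H^1$. For a family $\Delta$ of paths (continuous maps $\gamma\colon[0,1]\to\mathbb S^3$), the conformal modulus of $\Delta$ is $$\operatorname{Mod}_3(\Delta)=\inf_{\rho}\int_{\mathbb S^3}\rho^3\,\mathrm{dVol},$$ where the infimum is over all Borel measurable $\rho\colon\mathbb S^3\to[0,+\infty]$ with $\int_{\gamma([0,1])}\rho\,\mathrm d\mathscr H^1\ge 1$ for every $\gamma\in\Delta$. Let $$H_0=\{(z_1,0):|z_1|=1\},\qquad H_1=\{(0,z_2):|z_2|=1\}$$ be the two components of the Hopf link, and let $\Delta(H_0,H_1)$ be the family of all paths in $\mathbb S^3$ with one endpoint in $H_0$ and the other in $H_1$. Then $$\operatorname{Mod}_3(\Delta(H_0,H_1))=\frac{16\pi^3}{\Gamma(1/4)^4},$$ where $\Gamma(1/4)$ is the value of Euler's Gamma function. -/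

import Mathlib

open MeasureTheory

noncomputable section

/-- The class of densities admissible for a family `Γ` of paths `[0,1] → X`: measurable functions
`ρ : X → [0,∞]` with `∫_γ ρ dℋ¹ ≥ 1` for all `γ ∈ Γ`. The integral over a path is the integral over
its image with respect to one-dimensional Hausdorff measure. -/
def AdmissibleDensities {X : Type*} [EMetricSpace X] [MeasurableSpace X] [BorelSpace X]
    (Γ : Set C(unitInterval, X)) : Set (X → ENNReal) :=
  {ρ | Measurable ρ ∧ ∀ γ ∈ Γ, 1 ≤ ∫⁻ x in Set.range γ, ρ x ∂(Measure.hausdorffMeasure 1)}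

/-- The path `p`-modulus of `Γ` with respect to the volume measure `μ`. -/
def pathModulus {X : Type*} [EMetricSpace X] [MeasurableSpace X] [BorelSpace X]
    (μ : Measure X) (p : ℝ) (Γ : Set C(unitInterval, X)) : ENNReal :=
  ⨅ ρ ∈ AdmissibleDensities Γ, ∫⁻ x, ρ x ^ p ∂μ

/-- `Δ(C₀, C₁)`: the family of paths connecting `C₀` and `C₁`. -/
def connectingPaths {X : Type*} [TopologicalSpace X] (C₀ C₁ : Set X) : Set C(unitInterval, X) :=
  {γ | (γ 0 ∈ C₀ ∧ γ 1 ∈ C₁) ∨ (γ 0 ∈ C₁ ∧ γ 1 ∈ C₀)}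

/-- The unit sphere `𝕊³ = {(z₁, z₂) ∈ ℂ² : |z₁|² + |z₂|² = 1}`. Its metric is the chordal one, which
has the same one-dimensional Hausdorff measure as the geodesic distance of the round metric. -/
abbrev S3 : Type := Metric.sphere (0 : EuclideanSpace ℂ (Fin 2)) 1

/-- The Riemannian volume of the round metric on `𝕊³`: the surface measure induced by Lebesgue
measure on `ℂ² = ℝ⁴` (total mass `2π²`). -/
def volS3 : Measure S3 :=
  (volume : Measure (EuclideanSpace ℂ (Fin 2))).toSphere

/-- The component `H₀ = {(z₁, 0) : |z₁| = 1}` of the Hopf link. -/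
def hopfLink₀ : Set S3 := {x | ‖x.1 0‖ = 1 ∧ x.1 1 = 0}

/-- The component `H₁ = {(0, z₂) : |z₂| = 1}` of the Hopf link. -/
def hopfLink₁ : Set S3 := {x | x.1 0 = 0 ∧ ‖x.1 1‖ = 1}

end

/-!
In Hopf coordinates `(cos t e^{i θ₁}, sin t e^{i θ₂})`, `0 ≤ t ≤ π / 2`, the volume of `𝕊³` is
`cos t sin t dt dθ₁ dθ₂`. For fixed `θ` the coordinate `t` is arc length along a quarter of a great
circle joining the components of the link, so an admissible density has integral at least `1` over
it, and Hölder's inequality with the weight `w = cos t sin t` bounds `∫ w ρ³ dt` from below by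
`(∫ w ^ (-1/2) dt) ^ (-2)`. Conversely `t`, the distance to `H₀`, does not increase `ℋ¹` and
maps every connecting path onto `[0, π / 2]`; hence the function of `t` alone that gives equality in
Hölder's inequality is admissible. The modulus is therefore `(2π)² (∫ w ^ (-1/2) dt) ^ (-2)`, and
this integral is `B(1/4, 1/4) / 2 = Γ(1/4)² / (2 √π)`.
-/

open Set Filter Topology Real

section Hölder

variable {α : Type*} [MeasurableSpace α] {μ : Measure α} {p q : ℝ} {w f : α → ENNReal}

theorem lintegral_rpow_le_weighted_lintegral_rpow (hpq : p.HolderConjugate q)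
    (hw : AEMeasurable w μ) (hw₀ : ∀ᵐ x ∂μ, w x ≠ 0) (hw_top : ∀ᵐ x ∂μ, w x ≠ ⊤)
    (hf : AEMeasurable f μ) :
    (∫⁻ x, f x ∂μ) ^ p ≤ (∫⁻ x, w x * f x ^ p ∂μ) * (∫⁻ x, w x ^ (1 - q) ∂μ) ^ (p - 1) := by
  have hp : 0 < p := hpq.pos
  have h_split : ∫⁻ x, f x ∂μ =
      ∫⁻ x, ((fun x ↦ w x ^ p⁻¹ * f x) * fun x ↦ w x ^ (-p⁻¹)) x ∂μ := by
    refine lintegral_congr_ae ?_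
    filter_upwards [hw₀, hw_top] with x h₀ h_top
    rw [Pi.mul_apply, mul_right_comm, ← ENNReal.rpow_add _ _ h₀ h_top, add_neg_cancel,
      ENNReal.rpow_zero, one_mul]
  have h_left (x : α) : (w x ^ p⁻¹ * f x) ^ p = w x * f x ^ p := by
    rw [ENNReal.mul_rpow_of_nonneg _ _ hp.le, ENNReal.rpow_inv_rpow hp.ne']
  have h_right (x : α) : (w x ^ (-p⁻¹)) ^ q = w x ^ (1 - q) := by
    rw [← ENNReal.rpow_mul, neg_mul, inv_mul_eq_div, hpq.symm.div_conj_eq_sub_one, neg_sub]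
  calc (∫⁻ x, f x ∂μ) ^ p
      ≤ ((∫⁻ x, w x * f x ^ p ∂μ) ^ (1 / p) * (∫⁻ x, w x ^ (1 - q) ∂μ) ^ (1 / q)) ^ p := by
        rw [h_split]
        simp only [← h_left, ← h_right]
        gcongr
        exact ENNReal.lintegral_mul_le_Lp_mul_Lq μ hpq ((hw.pow_const _).mul hf) (hw.pow_const _)
    _ = (∫⁻ x, w x * f x ^ p ∂μ) * (∫⁻ x, w x ^ (1 - q) ∂μ) ^ (p - 1) := by
        rw [ENNReal.mul_rpow_of_nonneg _ _ hp.le, ← ENNReal.rpow_mul, ← ENNReal.rpow_mul,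
          one_div_mul_cancel hp.ne', ENNReal.rpow_one, one_div_mul_eq_div, hpq.div_conj_eq_sub_one]

theorem rpow_one_sub_le_weighted_lintegral_rpow (hpq : p.HolderConjugate q)
    (hw : AEMeasurable w μ) (hw₀ : ∀ᵐ x ∂μ, w x ≠ 0) (hw_top : ∀ᵐ x ∂μ, w x ≠ ⊤)
    (hf : AEMeasurable f μ) (hf_one : 1 ≤ ∫⁻ x, f x ∂μ) :
    (∫⁻ x, w x ^ (1 - q) ∂μ) ^ (1 - p) ≤ ∫⁻ x, w x * f x ^ p ∂μ := by
  rw [← neg_sub p, ENNReal.rpow_neg, ← one_div]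
  exact ENNReal.div_le_of_le_mul <| (ENNReal.one_le_rpow hf_one hpq.pos).trans <|
    lintegral_rpow_le_weighted_lintegral_rpow hpq hw hw₀ hw_top hf

/-- The normalised power `w ^ (1 - q) / ∫ w ^ (1 - q)`: an equality case of Hölder's inequality,
hence a minimiser of `∫ w f ^ p` among all `f` with `∫ f = 1`, where `p` is conjugate to `q`. -/
noncomputable def holderExtremal (μ : Measure α) (w : α → ENNReal) (q : ℝ) (x : α) : ENNReal :=
  (∫⁻ y, w y ^ (1 - q) ∂μ)⁻¹ * w x ^ (1 - q)

theorem measurable_holderExtremal (hw : Measurable w) : Measurable (holderExtremal μ w q) :=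
  (hw.pow_const _).const_mul _

theorem lintegral_holderExtremal (h₀ : ∫⁻ x, w x ^ (1 - q) ∂μ ≠ 0)
    (h_top : ∫⁻ x, w x ^ (1 - q) ∂μ ≠ ⊤) : ∫⁻ x, holderExtremal μ w q x ∂μ = 1 := by
  simp only [holderExtremal]
  rw [lintegral_const_mul' _ _ (ENNReal.inv_ne_top.2 h₀), ENNReal.inv_mul_cancel h₀ h_top]

theorem weighted_lintegral_holderExtremal_rpow (hpq : p.HolderConjugate q)
    (hw₀ : ∀ᵐ x ∂μ, w x ≠ 0) (hw_top : ∀ᵐ x ∂μ, w x ≠ ⊤)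
    (h₀ : ∫⁻ x, w x ^ (1 - q) ∂μ ≠ 0) (h_top : ∫⁻ x, w x ^ (1 - q) ∂μ ≠ ⊤) :
    ∫⁻ x, w x * holderExtremal μ w q x ^ p ∂μ = (∫⁻ x, w x ^ (1 - q) ∂μ) ^ (1 - p) := by
  set I := ∫⁻ x, w x ^ (1 - q) ∂μ
  have h_exponent : 1 + (1 - q) * p = 1 - q := by linarith [hpq.mul_eq_add]
  have h_integrand : ∀ᵐ x ∂μ, w x * holderExtremal μ w q x ^ p = I ^ (-p) * w x ^ (1 - q) := by
    filter_upwards [hw₀, hw_top] with x hx₀ hx_top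
    rw [holderExtremal, ENNReal.mul_rpow_of_nonneg _ _ hpq.nonneg, ← ENNReal.rpow_mul,
      ENNReal.inv_rpow, ← ENNReal.rpow_neg, mul_left_comm]
    nth_rw 1 [← ENNReal.rpow_one (w x)]
    rw [← ENNReal.rpow_add _ _ hx₀ hx_top, h_exponent]
  calc ∫⁻ x, w x * holderExtremal μ w q x ^ p ∂μ
      = ∫⁻ x, I ^ (-p) * w x ^ (1 - q) ∂μ := lintegral_congr_ae h_integrand
    _ = I ^ (-p) * I ^ (1 : ℝ) := by
        rw [lintegral_const_mul' _ _ (ENNReal.rpow_ne_top_of_ne_zero h₀ h_top), ENNReal.rpow_one]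
    _ = I ^ (1 - p) := by rw [← ENNReal.rpow_add _ _ h₀ h_top, neg_add_eq_sub]

end Hölder

section Modulus

theorem setLIntegral_le_setLIntegral_comp {X Y : Type*} [MeasurableSpace X] [MeasurableSpace Y]
    {μ : Measure X} {ν : Measure Y} {f : X → Y} (hf : Measurable f)
    (hfμ : ∀ A, ν (f '' A) ≤ μ A) {S : Set X} {T : Set Y} (hT : T ⊆ f '' S) {h : Y → ENNReal}
    (hh : Measurable h) : ∫⁻ y in T, h y ∂ν ≤ ∫⁻ x in S, h (f x) ∂μ := by
  rw [← lintegral_map hh hf]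
  refine lintegral_mono' (Measure.le_iff.2 fun B hB ↦ ?_) le_rfl
  rw [Measure.restrict_apply hB, Measure.map_apply hf hB, Measure.restrict_apply (hf hB)]
  calc ν (B ∩ T) ≤ ν (f '' (f ⁻¹' B ∩ S)) := by
        rw [image_preimage_inter]
        gcongr
    _ ≤ μ (f ⁻¹' B ∩ S) := hfμ _

variable {X : Type*} [EMetricSpace X] [MeasurableSpace X] [BorelSpace X] {μ : Measure X}
  {Γ : Set C(unitInterval, X)} {S : Set ℝ} {w : ℝ → ENNReal} {p q : ℝ}

theorem le_pathModulus_of_curves {A : Type*} [MeasurableSpace A] {ν : Measure A}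
    {c : A → ℝ → X} (hpq : p.HolderConjugate q) (hw : AEMeasurable w (volume.restrict S))
    (hw₀ : ∀ᵐ t ∂volume.restrict S, w t ≠ 0) (hw_top : ∀ᵐ t ∂volume.restrict S, w t ≠ ⊤)
    (hc : ∀ a, LipschitzWith 1 (c a)) (hΓ : ∀ a, ∃ γ ∈ Γ, range γ ⊆ c a '' S)
    (hμ : ∀ f, Measurable f → ∫⁻ a, (∫⁻ t in S, w t * f (c a t)) ∂ν ≤ ∫⁻ x, f x ∂μ) :
    ν univ * (∫⁻ t in S, w t ^ (1 - q)) ^ (1 - p) ≤ pathModulus μ p Γ := by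
  refine le_iInf₂ fun ρ hρ ↦ ?_
  have one_le (a : A) : 1 ≤ ∫⁻ t in S, ρ (c a t) := by
    obtain ⟨γ, hγ, hγS⟩ := hΓ a
    refine (hρ.2 γ hγ).trans <|
      setLIntegral_le_setLIntegral_comp (hc a).continuous.measurable (fun B ↦ ?_) hγS hρ.1
    simpa [hausdorffMeasure_real] using (hc a).hausdorffMeasure_image_le zero_le_one B
  calc ν univ * (∫⁻ t in S, w t ^ (1 - q)) ^ (1 - p)
      = ∫⁻ _, (∫⁻ t in S, w t ^ (1 - q)) ^ (1 - p) ∂ν := by rw [lintegral_const, mul_comm]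
    _ ≤ ∫⁻ a, (∫⁻ t in S, w t * ρ (c a t) ^ p) ∂ν := lintegral_mono fun a ↦
        rpow_one_sub_le_weighted_lintegral_rpow hpq hw hw₀ hw_top
          (hρ.1.comp (hc a).continuous.measurable).aemeasurable (one_le a)
    _ ≤ ∫⁻ x, ρ x ^ p ∂μ := hμ _ (hρ.1.pow_const p)

theorem pathModulus_le_of_projection {M : ENNReal} {u : X → ℝ} (hpq : p.HolderConjugate q)
    (hw : Measurable w)
    (hw₀ : ∀ᵐ t ∂volume.restrict S, w t ≠ 0) (hw_top : ∀ᵐ t ∂volume.restrict S, w t ≠ ⊤)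
    (h₀ : ∫⁻ t in S, w t ^ (1 - q) ≠ 0) (h_top : ∫⁻ t in S, w t ^ (1 - q) ≠ ⊤)
    (hu : Measurable u) (hu_vol : ∀ A, volume (u '' A) ≤ μH[1] A)
    (hΓ : ∀ γ ∈ Γ, S ⊆ u '' range γ)
    (hμ : ∀ h, Measurable h → ∫⁻ x, h (u x) ∂μ ≤ M * ∫⁻ t in S, w t * h t) :
    pathModulus μ p Γ ≤ M * (∫⁻ t in S, w t ^ (1 - q)) ^ (1 - p) := by
  set h := holderExtremal (volume.restrict S) w q
  have hh : Measurable h := measurable_holderExtremal hw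
  have h_admissible : h ∘ u ∈ AdmissibleDensities Γ := by
    refine ⟨hh.comp hu, fun γ hγ ↦ ?_⟩
    calc 1 = ∫⁻ t in S, h t := (lintegral_holderExtremal h₀ h_top).symm
      _ ≤ ∫⁻ x in range γ, h (u x) ∂μH[1] :=
        setLIntegral_le_setLIntegral_comp hu hu_vol (hΓ γ hγ) hh
  calc pathModulus μ p Γ ≤ ∫⁻ x, h (u x) ^ p ∂μ := iInf₂_le _ h_admissible
    _ ≤ M * ∫⁻ t in S, w t * h t ^ p := hμ _ (hh.pow_const p)
    _ = M * (∫⁻ t in S, w t ^ (1 - q)) ^ (1 - p) := by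
      rw [weighted_lintegral_holderExtremal_rpow hpq hw₀ hw_top h₀ h_top]

end Modulus

theorem hausdorffMeasure_image_le_of_locally_lipschitzOnWith {X Y : Type*} [EMetricSpace X]
    [SecondCountableTopology X] [MeasurableSpace X] [BorelSpace X] [EMetricSpace Y]
    [MeasurableSpace Y] [BorelSpace Y] {f : X → Y} {K : NNReal} {d : ℝ} (hd : 0 ≤ d)
    (hf : ∀ x, ∃ U ∈ 𝓝 x, LipschitzOnWith K f U) (A : Set X) :
    μH[d] (f '' A) ≤ K ^ d * μH[d] A := by
  choose U hU hfU using hf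
  obtain ⟨D, hD, hDU⟩ :=
    TopologicalSpace.countable_cover_nhds fun x ↦ interior_mem_nhds.2 (hU x)
  rcases D.eq_empty_or_nonempty with rfl | hD_nonempty
  · have : IsEmpty X := univ_eq_empty_iff.1 (by simpa using hDU.symm)
    simp [A.eq_empty_of_isEmpty]
  obtain ⟨e, rfl⟩ := hD.exists_eq_range hD_nonempty
  rw [biUnion_range] at hDU
  set B := disjointed fun n ↦ interior (U (e n))
  have hB : ⋃ n, B n = univ := iUnion_disjointed.trans hDU
  have hB_meas (n : ℕ) : MeasurableSet (B n) :=
    .disjointed (fun _ ↦ isOpen_interior.measurableSet) n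
  have hfB (n : ℕ) : LipschitzOnWith K f (A ∩ B n) :=
    (hfU (e n)).mono <| inter_subset_right.trans <|
      (disjointed_subset _ n).trans interior_subset
  calc μH[d] (f '' A) = μH[d] (⋃ n, f '' (A ∩ B n)) := by
        rw [← image_iUnion, ← inter_iUnion, hB, inter_univ]
    _ ≤ ∑' n, μH[d] (f '' (A ∩ B n)) := measure_iUnion_le _
    _ ≤ ∑' n, K ^ d * μH[d] (A ∩ B n) :=
        ENNReal.tsum_le_tsum fun n ↦ (hfB n).hausdorffMeasure_image_le hd
    _ = K ^ d * μH[d] A := by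
        rw [ENNReal.tsum_mul_left]
        simp only [inter_comm A]
        simp only [← Measure.restrict_apply (hB_meas _)]
        rw [← measure_iUnion (disjoint_disjointed _) hB_meas, hB,
          Measure.restrict_apply_univ]

theorem hausdorffMeasure_image_le_of_forall_one_lt {X Y : Type*} [EMetricSpace X]
    [SecondCountableTopology X] [MeasurableSpace X] [BorelSpace X] [EMetricSpace Y]
    [MeasurableSpace Y] [BorelSpace Y] {f : X → Y} {d : ℝ} (hd : 0 ≤ d)
    (hf : ∀ K : NNReal, 1 < K → ∀ x, ∃ U ∈ 𝓝 x, LipschitzOnWith K f U) (A : Set X) :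
    μH[d] (f '' A) ≤ μH[d] A := by
  have h_tendsto : Tendsto (fun K : NNReal ↦ (K : ENNReal) ^ d * μH[d] A) (𝓝[>] 1)
      (𝓝 (μH[d] A)) := by
    have h_cont : Continuous fun K : NNReal ↦ (K : ENNReal) ^ d :=
      ENNReal.continuous_rpow_const.comp ENNReal.continuous_coe
    have h_pow : Tendsto (fun K : NNReal ↦ (K : ENNReal) ^ d) (𝓝[>] 1) (𝓝 1) := by
      simpa using (h_cont.tendsto 1).mono_left nhdsWithin_le_nhds
    simpa using ENNReal.Tendsto.mul_const (b := μH[d] A) h_pow (.inl one_ne_zero)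
  refine ge_of_tendsto h_tendsto ?_
  filter_upwards [self_mem_nhdsWithin] with K hK
  exact hausdorffMeasure_image_le_of_locally_lipschitzOnWith hd (hf K hK) A

theorem strictMonoOn_sin_sq : StrictMonoOn (fun t ↦ sin t ^ 2) (Icc 0 (π / 2)) := by
  intro s hs t ht hst
  have h_sin : sin s < sin t :=
    strictMonoOn_sin ⟨by linarith [hs.1, pi_pos], hs.2⟩ ⟨by linarith [ht.1, pi_pos], ht.2⟩ hst
  exact pow_lt_pow_left₀ h_sin
    (sin_nonneg_of_nonneg_of_le_pi hs.1 (by linarith [hs.2, pi_pos])) two_ne_zero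

theorem sin_sq_image_Ioo : (fun t ↦ sin t ^ 2) '' Ioo 0 (π / 2) = Ioo 0 1 := by
  have h₀ : sin 0 ^ 2 = 0 := by simp
  have h₁ : sin (π / 2) ^ 2 = 1 := by simp
  refine Subset.antisymm ?_ ?_
  · simpa only [h₀, h₁] using strictMonoOn_sin_sq.mapsTo_Ioo.image_subset
  · simpa only [h₀, h₁] using intermediate_value_Ioo (by positivity)
      (by fun_prop : ContinuousOn (fun t ↦ sin t ^ 2) (Icc 0 (π / 2)))

theorem sin_pos_of_mem_Ioo_pi_div_two {t : ℝ} (ht : t ∈ Ioo 0 (π / 2)) : 0 < sin t :=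
  sin_pos_of_pos_of_lt_pi ht.1 (by linarith [ht.2, pi_pos])

theorem cos_pos_of_mem_Ioo_pi_div_two {t : ℝ} (ht : t ∈ Ioo 0 (π / 2)) : 0 < cos t :=
  cos_pos_of_mem_Ioo ⟨by linarith [ht.1, pi_pos], ht.2⟩

theorem lintegral_rpow_mul_one_sub_rpow {a b : ℝ} (ha : 0 < a) (hb : 0 < b) :
    ∫⁻ x in Ioo 0 1, ENNReal.ofReal (x ^ (a - 1) * (1 - x) ^ (b - 1)) =
      ENNReal.ofReal (ProbabilityTheory.beta a b) := by
  have h_beta := ProbabilityTheory.beta_pos ha hb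
  have h_pdf := ProbabilityTheory.lintegral_betaPDF_eq_one ha hb
  simp only [ProbabilityTheory.lintegral_betaPDF, mul_assoc,
    ENNReal.ofReal_mul (one_div_nonneg.2 h_beta.le)] at h_pdf
  rw [lintegral_const_mul' _ _ ENNReal.ofReal_ne_top, mul_comm] at h_pdf
  rw [ENNReal.eq_inv_of_mul_eq_one_left h_pdf, one_div, ENNReal.ofReal_inv_of_pos h_beta, inv_inv]

theorem lintegral_sin_rpow_mul_cos_rpow {a b : ℝ} (ha : 0 < a) (hb : 0 < b) :
    ∫⁻ t in Ioo 0 (π / 2), ENNReal.ofReal (sin t ^ (2 * a - 1) * cos t ^ (2 * b - 1)) =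
      ENNReal.ofReal (ProbabilityTheory.beta a b / 2) := by
  have h_integrand : ∀ t ∈ Ioo 0 (π / 2), ENNReal.ofReal (2 * sin t * cos t) *
      ENNReal.ofReal ((sin t ^ 2) ^ (a - 1) * (1 - sin t ^ 2) ^ (b - 1)) =
        2 * ENNReal.ofReal (sin t ^ (2 * a - 1) * cos t ^ (2 * b - 1)) := by
    intro t ht
    have hs := sin_pos_of_mem_Ioo_pi_div_two ht
    have hc := cos_pos_of_mem_Ioo_pi_div_two ht
    have h_pow {x : ℝ} (hx : 0 < x) (c : ℝ) : x * (x ^ 2) ^ (c - 1) = x ^ (2 * c - 1) := by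
      rw [← rpow_natCast, ← rpow_mul hx.le, mul_comm, ← rpow_add_one hx.ne']
      push_cast
      ring_nf
    rw [← ENNReal.ofReal_ofNat 2, ← ENNReal.ofReal_mul (by positivity),
      ← ENNReal.ofReal_mul (by positivity), ← cos_sq', ← h_pow hs, ← h_pow hc]
    ring_nf
  have h_subst := lintegral_image_eq_lintegral_deriv_mul_of_monotoneOn measurableSet_Ioo
    (fun t _ ↦ by simpa using ((hasDerivAt_sin t).fun_pow 2).hasDerivWithinAt)
    (strictMonoOn_sin_sq.monotoneOn.mono Ioo_subset_Icc_self)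
    fun x ↦ ENNReal.ofReal (x ^ (a - 1) * (1 - x) ^ (b - 1))
  rw [sin_sq_image_Ioo, lintegral_rpow_mul_one_sub_rpow ha hb,
    setLIntegral_congr_fun measurableSet_Ioo h_integrand,
    lintegral_const_mul' _ _ ENNReal.ofNat_ne_top] at h_subst
  rw [ENNReal.ofReal_div_of_pos two_pos, ENNReal.ofReal_ofNat]
  exact (ENNReal.eq_div_iff two_ne_zero ENNReal.ofNat_ne_top).2 h_subst.symm

theorem beta_one_fourth_one_fourth :
    ProbabilityTheory.beta (1 / 4) (1 / 4) = Gamma (1 / 4) ^ 2 / √π := by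
  rw [ProbabilityTheory.beta, ← Gamma_one_half_eq, ← sq]
  norm_num

theorem ofReal_cos_mul_sin_ne_zero :
    ∀ᵐ t ∂volume.restrict (Icc 0 (π / 2)), ENNReal.ofReal (cos t * sin t) ≠ 0 := by
  rw [← restrict_Ioo_eq_restrict_Icc]
  filter_upwards [ae_restrict_mem measurableSet_Ioo] with t ht
  exact (ENNReal.ofReal_pos.2 <| mul_pos (cos_pos_of_mem_Ioo_pi_div_two ht)
    (sin_pos_of_mem_Ioo_pi_div_two ht)).ne'

theorem lintegral_cos_mul_sin_rpow :
    ∫⁻ t in Icc 0 (π / 2), ENNReal.ofReal (cos t * sin t) ^ (1 - 3 / 2 : ℝ) =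
      ENNReal.ofReal (Gamma (1 / 4) ^ 2 / √π / 2) := by
  rw [← beta_one_fourth_one_fourth,
    ← lintegral_sin_rpow_mul_cos_rpow (by norm_num) (by norm_num), ← restrict_Ioo_eq_restrict_Icc]
  refine setLIntegral_congr_fun measurableSet_Ioo fun t ht ↦ ?_
  have hs := sin_pos_of_mem_Ioo_pi_div_two ht
  have hc := cos_pos_of_mem_Ioo_pi_div_two ht
  rw [ENNReal.ofReal_rpow_of_pos (mul_pos hc hs), mul_rpow hc.le hs.le, mul_comm]
  norm_num

theorem lintegral_complex_polar {f : ℂ → ENNReal} (hf : Measurable f) :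
    ∫⁻ z, f z = ∫⁻ θ in Ioo (-π) π, ∫⁻ r in Ioi (0 : ℝ),
      ENNReal.ofReal r * f (r * Complex.exp (θ * Complex.I)) := by
  rw [← Complex.lintegral_comp_polarCoord_symm, polarCoord_target, Measure.volume_eq_prod,
    setLIntegral_prod_symm]
  · simp only [Complex.polarCoord_symm_apply, Complex.exp_mul_I, Complex.ofReal_cos,
      Complex.ofReal_sin, smul_eq_mul]
  · simp only [Complex.polarCoord_symm_apply, smul_eq_mul]
    fun_prop

theorem lintegral_complex_prod_polar {G : ℂ × ℂ → ENNReal} (hG : Measurable G) :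
    ∫⁻ z, G z = ∫⁻ θ in Ioo (-π) π ×ˢ Ioo (-π) π, ∫⁻ r in Ioi (0 : ℝ), ∫⁻ s in Ioi (0 : ℝ),
      ENNReal.ofReal r * (ENNReal.ofReal s *
        G (r * Complex.exp (θ.1 * Complex.I), s * Complex.exp (θ.2 * Complex.I))) := by
  have h_inner (z : ℂ) : ∫⁻ w, G (z, w) = ∫⁻ β in Ioo (-π) π, ∫⁻ s in Ioi (0 : ℝ),
      ENNReal.ofReal s * G (z, s * Complex.exp (β * Complex.I)) :=
    lintegral_complex_polar (hG.comp measurable_prodMk_left)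
  have h_outer : Measurable fun θ : ℝ × ℝ ↦ ∫⁻ r in Ioi (0 : ℝ), ∫⁻ s in Ioi (0 : ℝ),
      ENNReal.ofReal r * (ENNReal.ofReal s *
        G (r * Complex.exp (θ.1 * Complex.I), s * Complex.exp (θ.2 * Complex.I))) := by
    fun_prop
  rw [Measure.volume_eq_prod, lintegral_prod _ hG.aemeasurable,
    lintegral_complex_polar hG.lintegral_prod_right', Measure.volume_eq_prod ℝ ℝ,
    setLIntegral_prod _ h_outer.aemeasurable]
  refine lintegral_congr fun α ↦ ?_
  simp only [h_inner, ← lintegral_const_mul' _ _ ENNReal.ofReal_ne_top]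
  exact lintegral_lintegral_swap (by fun_prop)

theorem polarCoord_symm_preimage_quadrant :
    polarCoord.target ∩ polarCoord.symm ⁻¹' (Ioi 0 ×ˢ Ioi 0) = Ioi 0 ×ˢ Ioo 0 (π / 2) := by
  ext ⟨r, t⟩
  simp only [polarCoord_target, mem_inter_iff, mem_prod, mem_preimage, polarCoord_symm_apply,
    mem_Ioi]
  constructor
  · rintro ⟨⟨hr, ht⟩, hc, hs⟩
    have h_pos : 0 < t := by
      by_contra! h
      exact (pos_of_mul_pos_right hs hr.le).not_ge (sin_nonpos_of_nonpos_of_neg_pi_le h ht.1.le)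
    have h_lt : t < π / 2 := by
      by_contra! h
      exact (pos_of_mul_pos_right hc hr.le).not_ge
        (cos_nonpos_of_pi_div_two_le_of_le h (by linarith [ht.2, pi_pos]))
    exact ⟨hr, h_pos, h_lt⟩
  · rintro ⟨hr, ht⟩
    exact ⟨⟨hr, by linarith [ht.1, pi_pos], by linarith [ht.2, pi_pos]⟩,
      mul_pos hr (cos_pos_of_mem_Ioo_pi_div_two ht), mul_pos hr (sin_pos_of_mem_Ioo_pi_div_two ht)⟩

theorem lintegral_quadrant_polar {G : ℝ × ℝ → ENNReal} (hG : Measurable G) :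
    ∫⁻ r in Ioi (0 : ℝ), ∫⁻ s in Ioi (0 : ℝ), G (r, s) =
      ∫⁻ t in Ioo 0 (π / 2), ∫⁻ r in Ioi (0 : ℝ),
        ENNReal.ofReal r * G (r * cos t, r * sin t) := by
  have hQ : MeasurableSet (Ioi (0 : ℝ) ×ˢ Ioi (0 : ℝ)) := measurableSet_Ioi.prod measurableSet_Ioi
  have h_preimage : MeasurableSet (polarCoord.symm ⁻¹' (Ioi (0 : ℝ) ×ˢ Ioi (0 : ℝ))) :=
    continuous_polarCoord_symm.measurable hQ
  calc ∫⁻ r in Ioi (0 : ℝ), ∫⁻ s in Ioi (0 : ℝ), G (r, s)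
      = ∫⁻ x in Ioi (0 : ℝ) ×ˢ Ioi (0 : ℝ), G x := by
        rw [Measure.volume_eq_prod, setLIntegral_prod _ hG.aemeasurable]
    _ = ∫⁻ x in polarCoord.target, ENNReal.ofReal x.1 *
          (Ioi 0 ×ˢ Ioi 0).indicator G (polarCoord.symm x) := by
        rw [← lintegral_indicator hQ, ← lintegral_comp_polarCoord_symm]
        simp only [smul_eq_mul]
    _ = ∫⁻ x in Ioi 0 ×ˢ Ioo 0 (π / 2), ENNReal.ofReal x.1 * G (polarCoord.symm x) := by
        rw [← polarCoord_symm_preimage_quadrant, inter_comm,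
          ← setLIntegral_indicator h_preimage]
        simp only [indicator_mul_right]
        rfl
    _ = ∫⁻ t in Ioo 0 (π / 2), ∫⁻ r in Ioi (0 : ℝ),
          ENNReal.ofReal r * G (r * cos t, r * sin t) := by
        rw [Measure.volume_eq_prod, setLIntegral_prod_symm]
        · simp only [polarCoord_symm_apply]
        · simp only [polarCoord_symm_apply]
          fun_prop

section Sphere

variable {E : Type*} [NormedAddCommGroup E] [NormedSpace ℝ E]

theorem lintegral_Ioi_pow_mul_indicator_ball (g : E → ENNReal) (n : ℕ) {x : E} (hx : ‖x‖ = 1) :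
    ∫⁻ r in Ioi (0 : ℝ), ENNReal.ofReal (r ^ n) *
        (Metric.ball 0 1).indicator (fun y ↦ g (‖y‖⁻¹ • y)) (r • x) =
      ENNReal.ofReal (1 / (n + 1)) * g x := by
  have h_integrand : ∀ r ∈ Ioi (0 : ℝ), ENNReal.ofReal (r ^ n) *
      (Metric.ball 0 1).indicator (fun y ↦ g (‖y‖⁻¹ • y)) (r • x) =
        (Iio 1).indicator (fun r ↦ ENNReal.ofReal (r ^ n) * g x) r := by
    intro r (hr : 0 < r)
    have h_norm : ‖r • x‖ = r := by rw [norm_smul, hx, mul_one, Real.norm_of_nonneg hr.le]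
    by_cases hr₁ : r < 1
    · rw [indicator_of_mem (mem_ball_zero_iff.2 (h_norm.trans_lt hr₁)),
        indicator_of_mem (mem_Iio.2 hr₁), h_norm, inv_smul_smul₀ hr.ne']
    · rw [indicator_of_notMem (by rwa [mem_ball_zero_iff, h_norm]),
        indicator_of_notMem (notMem_Iio.2 (not_lt.1 hr₁)), mul_zero]
  have h_pow : ∫⁻ r in Ioo (0 : ℝ) 1, ENNReal.ofReal (r ^ n) = ENNReal.ofReal (1 / (n + 1)) := by
    rw [restrict_Ioo_eq_restrict_Ioc, ← ofReal_integral_eq_lintegral_ofReal,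
      ← intervalIntegral.integral_of_le zero_le_one, integral_pow]
    · simp
    · exact (intervalIntegral.intervalIntegrable_pow n).1
    · filter_upwards [ae_restrict_mem measurableSet_Ioc] with r hr using pow_nonneg hr.1.le n
  rw [setLIntegral_congr_fun measurableSet_Ioi h_integrand,
    setLIntegral_indicator measurableSet_Iio, inter_comm, Ioi_inter_Iio,
    lintegral_mul_const _ (by fun_prop), h_pow]

variable [FiniteDimensional ℝ E] [Nontrivial E] [MeasurableSpace E] [BorelSpace E]
  {μ : Measure E} [μ.IsAddHaarMeasure]

theorem lintegral_eq_lintegral_toSphere {F : E → ENNReal} (hF : Measurable F) :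
    ∫⁻ x, F x ∂μ = ∫⁻ x, (∫⁻ r in Ioi (0 : ℝ),
      ENNReal.ofReal (r ^ (Module.finrank ℝ E - 1)) * F (r • (x : E))) ∂μ.toSphere := by
  have h_polar := μ.measurePreserving_homeomorphUnitSphereProd.lintegral_comp
    (f := fun x ↦ F ((x.2 : ℝ) • (x.1 : E))) (by fun_prop)
  calc ∫⁻ x, F x ∂μ = ∫⁻ x : ({0}ᶜ : Set E), F x ∂μ.comap (↑) := by
        rw [lintegral_subtype_comap (measurableSet_singleton 0).compl,
          restrict_compl_singleton]
    _ = ∫⁻ x, F ((x.2 : ℝ) • (x.1 : E))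
          ∂μ.toSphere.prod (Measure.volumeIoiPow (Module.finrank ℝ E - 1)) := by
        rw [← h_polar]
        refine lintegral_congr fun x ↦ ?_
        rw [← homeomorphUnitSphereProd_symm_apply_coe, Homeomorph.symm_apply_apply]
    _ = ∫⁻ x, (∫⁻ r in Ioi (0 : ℝ),
          ENNReal.ofReal (r ^ (Module.finrank ℝ E - 1)) * F (r • (x : E))) ∂μ.toSphere := by
        rw [lintegral_prod _ (by fun_prop)]
        refine lintegral_congr fun x ↦ ?_
        rw [Measure.volumeIoiPow, lintegral_withDensity_eq_lintegral_mul _ (by fun_prop)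
          (by fun_prop), ← lintegral_subtype_comap measurableSet_Ioi]
        rfl

theorem lintegral_toSphere_eq_of_polar {A : Type*} [MeasurableSpace A] {ν : Measure A}
    {σ : A → Metric.sphere (0 : E) 1} {W : A → ENNReal}
    (h_polar : ∀ F : E → ENNReal, Measurable F → ∫⁻ x, F x ∂μ =
      ∫⁻ a, W a * (∫⁻ r in Ioi (0 : ℝ),
        ENNReal.ofReal (r ^ (Module.finrank ℝ E - 1)) * F (r • (σ a : E))) ∂ν)
    {f : Metric.sphere (0 : E) 1 → ENNReal} (hf : Measurable f) :
    ∫⁻ x, f x ∂μ.toSphere = ∫⁻ a, W a * f (σ a) ∂ν := by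
  -- Test `h_polar` on the `0`-homogeneous extension of `f`, cut off to the unit ball.
  obtain ⟨g, hg, rfl⟩ := (MeasurableEmbedding.subtype_coe
    Metric.isClosed_sphere.measurableSet).exists_measurable_extend hf fun _ ↦ ⟨0⟩
  set F : E → ENNReal := (Metric.ball 0 1).indicator fun y ↦ g (‖y‖⁻¹ • y) with hF
  have hF_meas : Measurable F := (hg.comp (by fun_prop)).indicator measurableSet_ball
  have h_radial (x : Metric.sphere (0 : E) 1) := lintegral_Ioi_pow_mul_indicator_ball g
    (Module.finrank ℝ E - 1) (norm_eq_of_mem_sphere x)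
  set C : ENNReal := ENNReal.ofReal (1 / ((Module.finrank ℝ E - 1 : ℕ) + 1))
  have hC : C ≠ 0 := (ENNReal.ofReal_pos.2 (by positivity)).ne'
  have h_eq := (lintegral_eq_lintegral_toSphere hF_meas).symm.trans (h_polar F hF_meas)
  simp only [hF, h_radial, mul_left_comm _ C] at h_eq
  rwa [lintegral_const_mul' _ _ ENNReal.ofReal_ne_top, lintegral_const_mul' _ _
    ENNReal.ofReal_ne_top, ENNReal.mul_right_inj hC ENNReal.ofReal_ne_top] at h_eq

end Sphere

section HopfCoordinates

/-- The real-linear isometry `ℂ² ≃ ℂ × ℂ` between the two encodings of the Euclidean plane over `ℂ`,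
used to integrate over `ℂ²` one coordinate at a time. -/
noncomputable def euclideanProdEquiv : EuclideanSpace ℂ (Fin 2) ≃ₗᵢ[ℝ] WithLp 2 (ℂ × ℂ) where
  toFun x := WithLp.toLp 2 (x 0, x 1)
  invFun p := !₂[p.fst, p.snd]
  map_add' _ _ := rfl
  map_smul' _ _ := rfl
  left_inv x := by ext i; fin_cases i <;> rfl
  right_inv _ := rfl
  norm_map' x := by
    rw [WithLp.prod_norm_eq_of_L2, EuclideanSpace.norm_eq, Fin.sum_univ_two]
    rfl

theorem lintegral_euclideanSpace_complex_two {F : EuclideanSpace ℂ (Fin 2) → ENNReal}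
    (hF : Measurable F) : ∫⁻ x, F x = ∫⁻ z : ℂ × ℂ, F !₂[z.1, z.2] :=
  ((euclideanProdEquiv.symm.measurePreserving.comp
    (WithLp.volume_preserving_toLp ℂ ℂ)).lintegral_comp hF).symm

theorem finrank_real_euclideanSpace_complex_two :
    Module.finrank ℝ (EuclideanSpace ℂ (Fin 2)) = 4 := by
  rw [finrank_real_of_complex, finrank_euclideanSpace_fin]

/-- The point `(cos t e^{i θ₁}, sin t e^{i θ₂})` of `𝕊³` with Hopf coordinates `θ = (θ₁, θ₂)`
and `t`. -/
noncomputable def hopfPoint (θ : ℝ × ℝ) (t : ℝ) : S3 :=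
  ⟨!₂[cos t * Complex.exp (θ.1 * Complex.I), sin t * Complex.exp (θ.2 * Complex.I)], by
    rw [mem_sphere_zero_iff_norm, EuclideanSpace.norm_eq, Fin.sum_univ_two]
    simp [Complex.norm_exp_ofReal_mul_I, -Complex.ofReal_cos, -Complex.ofReal_sin]⟩

theorem continuous_hopfPoint : Continuous fun x : (ℝ × ℝ) × ℝ ↦ hopfPoint x.1 x.2 := by
  unfold hopfPoint
  fun_prop

theorem smul_hopfPoint (r : ℝ) (θ : ℝ × ℝ) (t : ℝ) :
    r • (hopfPoint θ t : EuclideanSpace ℂ (Fin 2)) =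
      !₂[(r * cos t : ℝ) * Complex.exp (θ.1 * Complex.I),
        (r * sin t : ℝ) * Complex.exp (θ.2 * Complex.I)] := by
  ext i
  fin_cases i <;> simp [hopfPoint, mul_assoc]

theorem lintegral_euclideanSpace_hopfPolar {F : EuclideanSpace ℂ (Fin 2) → ENNReal}
    (hF : Measurable F) :
    ∫⁻ x, F x = ∫⁻ θ in Ioo (-π) π ×ˢ Ioo (-π) π, ∫⁻ t in Ioo 0 (π / 2),
      ENNReal.ofReal (cos t * sin t) *
        ∫⁻ r in Ioi (0 : ℝ), ENNReal.ofReal (r ^ 3) * F (r • hopfPoint θ t) := by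
  rw [lintegral_euclideanSpace_complex_two hF, lintegral_complex_prod_polar (by fun_prop)]
  refine lintegral_congr fun θ ↦ ?_
  rw [lintegral_quadrant_polar (G := fun x ↦ ENNReal.ofReal x.1 * (ENNReal.ofReal x.2 *
    F !₂[x.1 * Complex.exp (θ.1 * Complex.I), x.2 * Complex.exp (θ.2 * Complex.I)])) (by fun_prop)]
  refine setLIntegral_congr_fun measurableSet_Ioo fun t ht ↦ ?_
  have hs := sin_pos_of_mem_Ioo_pi_div_two ht
  have hc := cos_pos_of_mem_Ioo_pi_div_two ht
  rw [← lintegral_const_mul' _ _ ENNReal.ofReal_ne_top]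
  refine setLIntegral_congr_fun measurableSet_Ioi fun r (hr : 0 < r) ↦ ?_
  simp only [← smul_hopfPoint, ← mul_assoc]
  rw [← ENNReal.ofReal_mul (by positivity), ← ENNReal.ofReal_mul (by positivity),
    ← ENNReal.ofReal_mul (by positivity)]
  ring_nf

theorem lintegral_volS3 {f : S3 → ENNReal} (hf : Measurable f) :
    ∫⁻ x, f x ∂volS3 = ∫⁻ θ in Ioo (-π) π ×ˢ Ioo (-π) π, ∫⁻ t in Icc 0 (π / 2),
      ENNReal.ofReal (cos t * sin t) * f (hopfPoint θ t) := by
  have h_meas := continuous_hopfPoint.measurable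
  rw [volS3, lintegral_toSphere_eq_of_polar (A := (ℝ × ℝ) × ℝ)
    (ν := (volume.restrict (Ioo (-π) π ×ˢ Ioo (-π) π)).prod (volume.restrict (Ioo 0 (π / 2))))
    (σ := fun x ↦ hopfPoint x.1 x.2) (W := fun x ↦ ENNReal.ofReal (cos x.2 * sin x.2)) _ hf,
    lintegral_prod _ (by fun_prop), restrict_Ioo_eq_restrict_Icc]
  intro F hF
  rw [lintegral_euclideanSpace_hopfPolar hF, finrank_real_euclideanSpace_complex_two,
    lintegral_prod _ (by fun_prop)]

end HopfCoordinates

section HopfLink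

theorem dist_hopfPoint_sq (θ : ℝ × ℝ) (s t : ℝ) :
    dist (hopfPoint θ s) (hopfPoint θ t) ^ 2 = 2 - 2 * cos (s - t) := by
  have h_ray (a b φ : ℝ) : dist (a * Complex.exp (φ * Complex.I))
      (b * Complex.exp (φ * Complex.I)) ^ 2 = (a - b) ^ 2 := by
    rw [dist_eq_norm, ← sub_mul, norm_mul, Complex.norm_exp_ofReal_mul_I, mul_one,
      ← Complex.ofReal_sub, Complex.norm_real, Real.norm_eq_abs, sq_abs]
  rw [Subtype.dist_eq, EuclideanSpace.dist_eq, Real.sq_sqrt (by positivity), Fin.sum_univ_two,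
    cos_sub]
  simp only [hopfPoint, Matrix.cons_val_zero, Matrix.cons_val_one, h_ray]
  linear_combination sin_sq_add_cos_sq s + sin_sq_add_cos_sq t

theorem lipschitzWith_hopfPoint (θ : ℝ × ℝ) : LipschitzWith 1 (hopfPoint θ) := by
  refine LipschitzWith.of_dist_le_mul fun s t ↦ ?_
  rw [NNReal.coe_one, one_mul, ← sq_le_sq₀ dist_nonneg dist_nonneg, dist_hopfPoint_sq,
    Real.dist_eq, sq_abs]
  linarith [one_sub_sq_div_two_le_cos (x := s - t)]

/-- The quarter of a great circle `t ↦ hopfPoint θ t`, `0 ≤ t ≤ π / 2`, joining `hopfLink₀` to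
`hopfLink₁`, parametrised by the unit interval. -/
noncomputable def hopfArc (θ : ℝ × ℝ) : C(unitInterval, S3) where
  toFun s := hopfPoint θ (π / 2 * s)
  continuous_toFun := (lipschitzWith_hopfPoint θ).continuous.comp (by fun_prop)

theorem hopfArc_mem_connectingPaths (θ : ℝ × ℝ) :
    hopfArc θ ∈ connectingPaths hopfLink₀ hopfLink₁ := by
  refine .inl ⟨?_, ?_⟩
  · simp [hopfArc, hopfLink₀, hopfPoint, Complex.norm_exp_ofReal_mul_I]
  · simp [hopfArc, hopfLink₁, hopfPoint, Complex.norm_exp_ofReal_mul_I, -Complex.ofReal_cos,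
      -Complex.ofReal_sin]

theorem range_hopfArc_subset (θ : ℝ × ℝ) : range (hopfArc θ) ⊆ hopfPoint θ '' Icc 0 (π / 2) := by
  rintro _ ⟨s, rfl⟩
  exact ⟨π / 2 * s, ⟨mul_nonneg (by positivity) s.2.1,
    mul_le_of_le_one_right (by positivity) s.2.2⟩, rfl⟩

/-- The Hopf coordinate `t ∈ [0, π / 2]` of a point of `𝕊³`, which is its geodesic distance to
`hopfLink₀`. -/
noncomputable def hopfAngle (x : S3) : ℝ := arcsin ‖x.1 1‖

theorem continuous_hopfAngle : Continuous hopfAngle := by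
  unfold hopfAngle
  fun_prop

theorem norm_sq_add_norm_sq (x : S3) : ‖x.1 0‖ ^ 2 + ‖x.1 1‖ ^ 2 = 1 := by
  have h_norm := norm_eq_of_mem_sphere x
  rwa [EuclideanSpace.norm_eq, Fin.sum_univ_two, Real.sqrt_eq_one] at h_norm

theorem sin_hopfAngle (x : S3) : sin (hopfAngle x) = ‖x.1 1‖ :=
  sin_arcsin (by linarith [norm_nonneg (x.1 1)]) <|
    (sq_le_one_iff₀ (norm_nonneg _)).1 (by linarith [norm_sq_add_norm_sq x, sq_nonneg ‖x.1 0‖])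

theorem cos_hopfAngle (x : S3) : cos (hopfAngle x) = ‖x.1 0‖ := by
  rw [hopfAngle, cos_arcsin, ← eq_sub_of_add_eq (norm_sq_add_norm_sq x),
    Real.sqrt_sq (norm_nonneg _)]

theorem hopfAngle_hopfPoint (θ : ℝ × ℝ) {t : ℝ} (ht : t ∈ Icc 0 (π / 2)) :
    hopfAngle (hopfPoint θ t) = t := by
  have h_sin : 0 ≤ sin t := sin_nonneg_of_nonneg_of_le_pi ht.1 (by linarith [ht.2, pi_pos])
  have h_norm : ‖(hopfPoint θ t).1 1‖ = sin t := by
    simp only [hopfPoint, Matrix.cons_val_one, Matrix.cons_val_zero, norm_mul,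
      Complex.norm_exp_ofReal_mul_I, mul_one, Complex.norm_real, Real.norm_of_nonneg h_sin]
  rw [hopfAngle, h_norm, arcsin_sin (by linarith [ht.1, pi_pos]) ht.2]

/- The left-hand side is the squared chord between the angles of `x` and `y` on the unit circle, and
`x ↦ (‖x 0‖, ‖x 1‖) = (cos (hopfAngle x), sin (hopfAngle x))` is `1`-Lipschitz. -/
theorem two_sub_two_mul_cos_hopfAngle_sub_le (x y : S3) :
    2 - 2 * cos (hopfAngle x - hopfAngle y) ≤ dist x y ^ 2 := by
  have h_coord (i : Fin 2) : (‖x.1 i‖ - ‖y.1 i‖) ^ 2 ≤ dist (x.1 i) (y.1 i) ^ 2 := by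
    rw [dist_eq_norm, sq_le_sq, abs_norm]
    exact abs_norm_sub_norm_le _ _
  calc 2 - 2 * cos (hopfAngle x - hopfAngle y)
      = (‖x.1 0‖ - ‖y.1 0‖) ^ 2 + (‖x.1 1‖ - ‖y.1 1‖) ^ 2 := by
        rw [cos_sub, cos_hopfAngle, cos_hopfAngle, sin_hopfAngle, sin_hopfAngle]
        linear_combination -norm_sq_add_norm_sq x - norm_sq_add_norm_sq y
    _ ≤ dist x y ^ 2 := by
        rw [Subtype.dist_eq, EuclideanSpace.dist_eq, Real.sq_sqrt (by positivity),
          Fin.sum_univ_two]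
        exact add_le_add (h_coord 0) (h_coord 1)

theorem eventually_sq_le_mul_two_sub_two_mul_cos {K : ℝ} (hK : 1 < K) :
    ∀ᶠ t in 𝓝 0, t ^ 2 ≤ K ^ 2 * (2 - 2 * cos t) := by
  have h_cont : Continuous fun t : ℝ ↦ K ^ 2 * (1 - 5 / 48 * t ^ 2) := by fun_prop
  have h_large : ∀ᶠ t in 𝓝 (0 : ℝ), 1 < K ^ 2 * (1 - 5 / 48 * t ^ 2) :=
    h_cont.continuousAt.eventually_const_lt (by simpa using one_lt_pow₀ hK two_ne_zero)
  have h_small : ∀ᶠ t in 𝓝 (0 : ℝ), |t| < 1 :=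
    continuous_abs.continuousAt.eventually_lt_const (by simp)
  filter_upwards [h_large, h_small] with t ht_large ht_small
  have h_cos : t ^ 2 * (1 - 5 / 48 * t ^ 2) ≤ 2 - 2 * cos t := by
    have h_bound := (abs_le.1 (cos_bound ht_small.le)).2
    rw [Even.pow_abs (by decide : Even 4)] at h_bound
    linarith
  calc t ^ 2 ≤ t ^ 2 * (K ^ 2 * (1 - 5 / 48 * t ^ 2)) :=
        le_mul_of_one_le_right (sq_nonneg t) ht_large.le
    _ = K ^ 2 * (t ^ 2 * (1 - 5 / 48 * t ^ 2)) := mul_left_comm _ _ _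
    _ ≤ K ^ 2 * (2 - 2 * cos t) := by gcongr

theorem exists_lipschitzOnWith_hopfAngle {K : NNReal} (hK : 1 < K) (x : S3) :
    ∃ U ∈ 𝓝 x, LipschitzOnWith K hopfAngle U := by
  have h_tendsto : Tendsto (fun y : S3 × S3 ↦ hopfAngle y.1 - hopfAngle y.2)
      (𝓝 x ×ˢ 𝓝 x) (𝓝 0) := by
    simpa using ((continuous_hopfAngle.tendsto x).comp tendsto_fst).sub
      ((continuous_hopfAngle.tendsto x).comp tendsto_snd)
  obtain ⟨U, hU, hU_le⟩ := eventually_prod_self_iff'.1 <|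
    h_tendsto.eventually (eventually_sq_le_mul_two_sub_two_mul_cos (NNReal.coe_lt_coe.2 hK))
  refine ⟨U, hU, LipschitzOnWith.of_dist_le_mul fun y hy z hz ↦ ?_⟩
  rw [← sq_le_sq₀ dist_nonneg (by positivity), Real.dist_eq, sq_abs, mul_pow]
  exact (hU_le y hy z hz).trans <| by
    gcongr
    exact two_sub_two_mul_cos_hopfAngle_sub_le y z

theorem volume_hopfAngle_image_le (A : Set S3) : volume (hopfAngle '' A) ≤ μH[1] A := by
  rw [← hausdorffMeasure_real]
  exact hausdorffMeasure_image_le_of_forall_one_lt zero_le_one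
    (fun _ ↦ exists_lipschitzOnWith_hopfAngle) A

theorem Icc_subset_hopfAngle_image_range {γ : C(unitInterval, S3)}
    (hγ : γ ∈ connectingPaths hopfLink₀ hopfLink₁) : Icc 0 (π / 2) ⊆ hopfAngle '' range γ := by
  have h_zero {x : S3} (hx : x ∈ hopfLink₀) : hopfAngle x = 0 := by simp [hopfAngle, hx.2]
  have h_pi_div_two {x : S3} (hx : x ∈ hopfLink₁) : hopfAngle x = π / 2 := by
    simp [hopfAngle, hx.2]
  have h_connected : (hopfAngle '' range γ).OrdConnected :=
    ((isPreconnected_range γ.continuous).image _ continuous_hopfAngle.continuousOn).ordConnected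
  have h_mem (s : unitInterval) : hopfAngle (γ s) ∈ hopfAngle '' range γ :=
    mem_image_of_mem _ (mem_range_self s)
  rcases hγ with ⟨hγ₀, hγ₁⟩ | ⟨hγ₀, hγ₁⟩
  · simpa only [h_zero hγ₀, h_pi_div_two hγ₁] using h_connected.out (h_mem 0) (h_mem 1)
  · simpa only [h_zero hγ₁, h_pi_div_two hγ₀] using h_connected.out (h_mem 1) (h_mem 0)

theorem volume_Ioo_neg_pi_pi_sq :
    volume (Ioo (-π) π ×ˢ Ioo (-π) π) = ENNReal.ofReal ((2 * π) ^ 2) := by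
  rw [Measure.volume_eq_prod, Measure.prod_prod, Real.volume_Ioo,
    ← ENNReal.ofReal_mul (by linarith [pi_pos])]
  ring_nf

theorem lintegral_volS3_comp_hopfAngle {h : ℝ → ENNReal} (hh : Measurable h) :
    ∫⁻ x, h (hopfAngle x) ∂volS3 =
      ENNReal.ofReal ((2 * π) ^ 2) *
        ∫⁻ t in Icc 0 (π / 2), ENNReal.ofReal (cos t * sin t) * h t := by
  have h_arc (θ : ℝ × ℝ) : ∫⁻ t in Icc 0 (π / 2),
      ENNReal.ofReal (cos t * sin t) * h (hopfAngle (hopfPoint θ t)) =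
        ∫⁻ t in Icc 0 (π / 2), ENNReal.ofReal (cos t * sin t) * h t :=
    setLIntegral_congr_fun measurableSet_Icc fun t ht ↦ by simp only [hopfAngle_hopfPoint θ ht]
  rw [lintegral_volS3 (f := fun x ↦ h (hopfAngle x)) (hh.comp continuous_hopfAngle.measurable)]
  simp only [h_arc]
  rw [setLIntegral_const, volume_Ioo_neg_pi_pi_sq, mul_comm]

end HopfLink

theorem pathModulus_connectingPaths_hopfLink :
    pathModulus volS3 3 (connectingPaths hopfLink₀ hopfLink₁) = ENNReal.ofReal ((2 * π) ^ 2) *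
      (∫⁻ t in Icc 0 (π / 2), ENNReal.ofReal (cos t * sin t) ^ (1 - 3 / 2 : ℝ)) ^ (1 - 3 : ℝ) := by
  have h_exponents : (3 : ℝ).HolderConjugate (3 / 2) := by
    rw [Real.holderConjugate_iff]
    norm_num
  have h_meas : Measurable fun t ↦ ENNReal.ofReal (cos t * sin t) := by fun_prop
  have h_top : ∀ᵐ t ∂volume.restrict (Icc 0 (π / 2)), ENNReal.ofReal (cos t * sin t) ≠ ⊤ :=
    .of_forall fun _ ↦ ENNReal.ofReal_ne_top
  refine le_antisymm ?_ ?_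
  · exact pathModulus_le_of_projection h_exponents h_meas ofReal_cos_mul_sin_ne_zero h_top
      (by rw [lintegral_cos_mul_sin_rpow]; exact (ENNReal.ofReal_pos.2 (by positivity)).ne')
      (by rw [lintegral_cos_mul_sin_rpow]; exact ENNReal.ofReal_ne_top)
      continuous_hopfAngle.measurable volume_hopfAngle_image_le
      (fun _ ↦ Icc_subset_hopfAngle_image_range) fun _ hh ↦ (lintegral_volS3_comp_hopfAngle hh).le
  · rw [← volume_Ioo_neg_pi_pi_sq, ← Measure.restrict_apply_univ]
    exact le_pathModulus_of_curves h_exponents h_meas.aemeasurable ofReal_cos_mul_sin_ne_zero h_top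
      lipschitzWith_hopfPoint
      (fun θ ↦ ⟨hopfArc θ, hopfArc_mem_connectingPaths θ, range_hopfArc_subset θ⟩)
      fun _ hf ↦ (lintegral_volS3 hf).ge

theorem mainTheorem5 :
    pathModulus volS3 3 (connectingPaths hopfLink₀ hopfLink₁) =
      ENNReal.ofReal (16 * Real.pi ^ 3 / Real.Gamma (1 / 4) ^ 4) := by
  rw [pathModulus_connectingPaths_hopfLink, lintegral_cos_mul_sin_rpow,
    ENNReal.ofReal_rpow_of_pos (by positivity), ← ENNReal.ofReal_mul (by positivity)]
  congr 1
  rw [show (1 - 3 : ℝ) = -(2 : ℕ) by norm_num, rpow_neg (by positivity), rpow_natCast, div_pow,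
    div_pow, Real.sq_sqrt pi_pos.le]
  field_simp
  norm_num
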